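/- **Theorem (generalized Aubin–Lions lemma).** Let $T,L>0$ and let $I\subset\mathbb R$ be a bounded open interval. Let $\mathcal M_L$ be the set of nonnegative Radon measures on $\mathbb R$ with compact support and total mass $L$; an absolutely continuous element of $\mathcal M_L$ is identified with its density. For $\mu,\nu\in\mathcal M_L$ let $F_\mu(x)=\mu(]-\infty,x])$ and let $d_{L,1}(\mu,\nu)=\|F_\mu-F_\nu\|_{L^1(\mathbb R)}$ be the scaled $1$-Wasserstein distance. Let $w:\mathbb R\to\mathbb R$ be Lipschitz continuous and strictly monotone (increasing or decreasing). Let $(\rho^n)_{n\in\mathbb N}$ be a sequence in $L^\infty(]0,T[\times\mathbb R)$ with $\rho^n(t)\in\mathcal M_L$ for all $t\in\,]0,T[$ and $n\in\mathbb N$. Assume that $|w(r)|\to\infty$ as $r\to+\infty$, or that $(\rho^n)_n$ is bounded in $L^\infty(]0,T[\times\mathbb R)$. Suppose moreover that 1. $\rho^n:\,]0,T[\,\to L^1(\mathbb R)$ is measurable for all $n\in\mathbb N$; 2. $\operatorname{spt}(\rho^n(t))\subseteq I$ for all $t\in\,]0,T[$ and $n\in\mathbb N$; 3. $\displaystyle\sup_{n\in\mathbb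 N}\int_0^T\Big(\|w(\rho^n(t))\|_{L^1(I)}+TV\big[w(\rho^n(t));I\big]\Big)\,dt<+\infty$, where $TV[f;I]$ is the total variation on $I$ of the a.e.-equivalence class of $f$, that is, the infimum over all representatives of the pointwise variation on $I$; 4. there is a constant $C$, independent of $n$, such that $d_{L,1}(\rho^n(s),\rho^n(t))\le C|t-s|$ for all $s,t\in\,]0,T[$ and $n\in\mathbb N$. Then $(\rho^n)_{n\in\mathbb N}$ is strongly relatively compact in $L^1(]0,T[\times\mathbb R)$. -/

import Mathlib

open MeasureTheory Set Filter

noncomputable section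

/-- The space `M_L` of (nonnegative) Radon measures on `ℝ` with compact support and total mass `L`.
A finite Borel measure on `ℝ` is automatically Radon. -/
def massClass (L : ℝ) : Set (Measure ℝ) :=
  {μ | IsCompact μ.support ∧ μ univ = ENNReal.ofReal L}

/-- The cumulative distribution `x ↦ μ(]-∞, x])`. -/
def cumul (μ : Measure ℝ) (x : ℝ) : ℝ := μ.real (Iic x)

/-- The scaled `1`-Wasserstein distance on `massClass L`, i.e. the `L¹(ℝ)` norm of the difference
of the cumulative distributions. -/
def scaledW1 (μ ν : Measure ℝ) : ENNReal :=
  eLpNorm (fun x => cumul μ x - cumul ν x) 1 volume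

/-- The absolutely continuous measure `f dx` of a nonnegative density `f`. -/
def densityMeasure (f : ℝ → ℝ) : Measure ℝ :=
  volume.withDensity (fun x => ENNReal.ofReal (f x))

/-- The total variation on the set `I` of the class of `f` modulo a.e. equality: the infimum of the
pointwise variations on `I` over all representatives. On an open interval it equals the
total variation of the distributional derivative. -/
def essVariation (f : ℝ → ℝ) (I : Set ℝ) : ENNReal :=
  ⨅ (g : ℝ → ℝ) (_ : g =ᵐ[volume.restrict I] f), eVariationOn g I

/-- The time-dependent function `f` is a measurable map `]0,T[ → L¹(ℝ)`. As `L¹(ℝ)` is separable,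
strong measurability is the same as Borel measurability. -/
def MeasurableIntoL1 (T : ℝ) (f : ℝ → ℝ → ℝ) : Prop :=
  ∃ g : Ioo (0 : ℝ) T → Lp ℝ 1 (volume : Measure ℝ),
    StronglyMeasurable g ∧ ∀ t : Ioo (0 : ℝ) T, g t =ᵐ[volume] f t

/-- Lebesgue measure on the strip `]0,T[ × ℝ`. -/
def stripMeasure (T : ℝ) : Measure (ℝ × ℝ) :=
  volume.restrict (Ioo 0 T ×ˢ univ)

/-- The sequence of functions `f n` lies in `L¹(μ)` and is relatively compact there for the norm
topology. -/
def RelativelyCompactInL1 {α : Type*} [MeasurableSpace α] (μ : Measure α) (f : ℕ → α → ℝ) : Prop :=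
  ∃ h : ∀ n, MemLp (f n) 1 μ, IsCompact (closure (range fun n => (h n).toLp (f n)))

end

/-!
The proof exhibits a finite `ε`-net for the sequence in `L¹(]0,T[ × ℝ)`, by comparing each density
with its average `rightAverage h` over an interval of small length `h`.

On the one hand the averages approximate the densities uniformly in `n`, after integration in time
(`exists_lintegral_sub_rightAverage_le`). A bound on `‖w ∘ u‖_{L¹} + TV[w ∘ u]` controls the
translates of `w ∘ u` in `L¹` (`lintegral_translate_sub_le_essVariation`) and, if `|w|` is coercive,
also the supremum of `u`. As `w` is continuous and injective, one has `|r - s| ≤ ε + c |w r - w s|`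
on bounded intervals (`exists_abs_sub_le_add_mul`), so the translates of `u` itself are controlled.
At times where `‖w ∘ u‖_{L¹} + TV[w ∘ u]` exceeds a large `M`, the trivial bound `2 L` on the
`L¹` distance is used; these times contribute at most `2 L / M` times the integral of that quantity.

On the other hand the average is a difference quotient of the distribution function, so the `L¹`
distance between two averages is at most `2 / h` times the scaled Wasserstein distance
(`lintegral_rightAverage_sub_le`). Finitely many of the curves `t ↦ ρⁿ(t)` approximate all of them
uniformly in time for this distance (`exists_finite_forall_scaledW1_le`): the curves are
equi-Lipschitz in time and the distribution functions are monotone and bounded, so it is enough to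
compare finitely many values, on a grid in time and space.
-/

/-! ### Spatial estimates for functions of bounded variation -/

/-- Translating by `y` changes a function by at most `y` times its variation in `L¹`: the increment
`|g (x + y) - g x|` is at most `v (x + y) - v x`, where `v x` is the variation of `g` up to `x`, and
the integral of `v (x + y) - v x` telescopes. -/
theorem lintegral_translate_sub_le (g : ℝ → ℝ) (a b : ℝ) {y : ℝ} (hy : 0 < y) :
    ∫⁻ x in Ioo a (b - y), ‖g (x + y) - g x‖ₑ ≤
      ENNReal.ofReal y * eVariationOn g (Ioo a b) := by
  set V := eVariationOn g (Ioo a b) with hV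
  rcases eq_or_ne V ⊤ with hVt | hVt
  · rw [hVt, ENNReal.mul_top (by simpa using hy)]
    exact le_top
  rcases le_or_gt (b - y) a with hab | hab
  · rw [Ioo_eq_empty (not_lt.2 hab)]
    simp
  let v : ℝ → ENNReal := fun x => eVariationOn g (Ioo a b ∩ Iic x)
  have hvmono : Monotone v := fun x z hxz =>
    eVariationOn.mono g (inter_subset_inter_right _ (Iic_subset_Iic.2 hxz))
  have hvV : ∀ x, v x ≤ V := fun x => eVariationOn.mono g inter_subset_left
  have hvmeas : Measurable v := hvmono.measurable
  have hpt : ∀ x ∈ Ioo a (b - y), ‖g (x + y) - g x‖ₑ + v x ≤ v (x + y) := by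
    intro x hx
    have h1 : ‖g (x + y) - g x‖ₑ ≤ eVariationOn g (Icc x (x + y)) := by
      rw [← edist_eq_enorm_sub]
      exact eVariationOn.edist_le g (right_mem_Icc.2 (by linarith)) (left_mem_Icc.2 (by linarith))
    calc ‖g (x + y) - g x‖ₑ + v x
        ≤ v x + eVariationOn g (Icc x (x + y)) := by rw [add_comm]; gcongr
      _ ≤ eVariationOn g ((Ioo a b ∩ Iic x) ∪ Icc x (x + y)) :=
        eVariationOn.add_le_union g fun p hp q hq => hp.2.trans hq.1
      _ ≤ v (x + y) := by
        refine eVariationOn.mono g (union_subset ?_ ?_)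
        · exact inter_subset_inter_right _ (Iic_subset_Iic.2 (by linarith))
        · exact fun p hp => ⟨⟨hx.1.trans_le hp.1, hp.2.trans_lt (by linarith [hx.2])⟩, hp.2⟩
  have hshift : ∫⁻ x in Ioo a (b - y), v (x + y) = ∫⁻ x in Ioo (a + y) b, v x := by
    have := (measurePreserving_add_right (volume : Measure ℝ) y).setLIntegral_comp_preimage
      (s := Ioo (a + y) b) measurableSet_Ioo hvmeas
    rw [← this]
    simp
  have hfin : ∫⁻ x in Ioo a (b - y), v x ≠ ⊤ := by
    refine ne_top_of_le_ne_top ?_ (lintegral_mono hvV)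
    rw [lintegral_const]
    exact ENNReal.mul_ne_top hVt (by simp)
  refine ENNReal.le_of_add_le_add_right hfin ?_
  calc (∫⁻ x in Ioo a (b - y), ‖g (x + y) - g x‖ₑ) + ∫⁻ x in Ioo a (b - y), v x
      = ∫⁻ x in Ioo a (b - y), (‖g (x + y) - g x‖ₑ + v x) := (lintegral_add_right _ hvmeas).symm
    _ ≤ ∫⁻ x in Ioo a (b - y), v (x + y) := setLIntegral_mono' measurableSet_Ioo hpt
    _ = ∫⁻ x in Ioo (a + y) b, v x := hshift
    _ ≤ ∫⁻ x in Ico (b - y) b ∪ Ioo a (b - y), v x := by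
      refine lintegral_mono_set fun x hx => ?_
      rcases le_or_gt (b - y) x with h | h
      · exact Or.inl ⟨h, hx.2⟩
      · exact Or.inr ⟨by linarith [hx.1], h⟩
    _ ≤ (∫⁻ x in Ico (b - y) b, v x) + ∫⁻ x in Ioo a (b - y), v x := lintegral_union_le _ _ _
    _ ≤ ENNReal.ofReal y * V + ∫⁻ x in Ioo a (b - y), v x := by
      gcongr
      refine (lintegral_mono hvV).trans_eq ?_
      rw [setLIntegral_const, Real.volume_Ico, mul_comm]
      congr 2
      ring

theorem ae_restrict_translate {a b y : ℝ} (hy : 0 < y) {g f : ℝ → ℝ}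
    (h : g =ᵐ[volume.restrict (Ioo a b)] f) :
    ∀ᵐ x ∂volume.restrict (Ioo a (b - y)), g (x + y) - g x = f (x + y) - f x := by
  rw [EventuallyEq, ae_restrict_iff' measurableSet_Ioo] at h
  rw [ae_restrict_iff' measurableSet_Ioo]
  have h2 := (quasiMeasurePreserving_add_right (volume : Measure ℝ) y).ae h
  filter_upwards [h, h2] with x h1 h2 hx
  rw [h1 ⟨hx.1, by linarith [hx.2]⟩, h2 ⟨by linarith [hx.1], by linarith [hx.2]⟩]

theorem lintegral_translate_sub_le_essVariation (f : ℝ → ℝ) (a b : ℝ) {y : ℝ} (hy : 0 < y) :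
    ∫⁻ x in Ioo a (b - y), ‖f (x + y) - f x‖ₑ ≤
      ENNReal.ofReal y * essVariation f (Ioo a b) := by
  have hy0 : ENNReal.ofReal y ≠ 0 := by simpa using hy
  rw [mul_comm, ← ENNReal.div_le_iff hy0 ENNReal.ofReal_ne_top]
  refine le_iInf₂ fun g hg => ?_
  rw [ENNReal.div_le_iff hy0 ENNReal.ofReal_ne_top, mul_comm]
  refine le_trans (le_of_eq ?_) (lintegral_translate_sub_le g a b hy)
  refine lintegral_congr_ae ?_
  filter_upwards [ae_restrict_translate hy hg] with x hx
  rw [hx]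

theorem essVariation_congr {f g : ℝ → ℝ} {I : Set ℝ} (h : f =ᵐ[volume.restrict I] g) :
    essVariation f I = essVariation g I := by
  unfold essVariation
  congr! 3 with k
  exact ⟨fun hk => hk.trans h, fun hk => hk.trans h.symm⟩

/-- A function is bounded by its mean absolute value plus its variation. The slack `M + 1` makes
room for a representative whose variation exceeds the infimum. -/
theorem ae_abs_le_of_essVariation_le {a b : ℝ} (hab : a < b) {f : ℝ → ℝ} {M : ℝ}
    (hM : 0 ≤ M) (h : eLpNorm f 1 (volume.restrict (Ioo a b)) + essVariation f (Ioo a b) ≤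
      ENNReal.ofReal M) :
    ∀ᵐ x ∂volume.restrict (Ioo a b), |f x| ≤ M / (b - a) + (M + 1) := by
  have hba : 0 < b - a := by linarith
  have h1 : ∫⁻ x in Ioo a b, ‖f x‖ₑ ≤ ENNReal.ofReal M := by
    rw [← eLpNorm_one_eq_lintegral_enorm]
    exact le_self_add.trans h
  have h2 : essVariation f (Ioo a b) < ENNReal.ofReal (M + 1) :=
    (le_add_self.trans h).trans_lt ((ENNReal.ofReal_lt_ofReal_iff (by linarith)).2 (by linarith))
  obtain ⟨g, hg, hgV⟩ := by simpa only [essVariation, iInf_lt_iff, exists_prop] using h2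
  filter_upwards [hg, ae_restrict_mem measurableSet_Ioo] with x hx hxI
  rw [← hx]
  have key : ‖g x‖ₑ * ENNReal.ofReal (b - a) ≤
      ENNReal.ofReal M + ENNReal.ofReal (M + 1) * ENNReal.ofReal (b - a) := by
    calc ‖g x‖ₑ * ENNReal.ofReal (b - a) = ∫⁻ _ in Ioo a b, ‖g x‖ₑ := by
          rw [setLIntegral_const, Real.volume_Ioo]
      _ ≤ ∫⁻ z in Ioo a b, (‖g z‖ₑ + ENNReal.ofReal (M + 1)) := by
        refine setLIntegral_mono' measurableSet_Ioo fun z hz => ?_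
        calc ‖g x‖ₑ = ‖g z + (g x - g z)‖ₑ := by congr 1; ring
          _ ≤ ‖g z‖ₑ + ‖g x - g z‖ₑ := enorm_add_le _ _
          _ ≤ ‖g z‖ₑ + ENNReal.ofReal (M + 1) := by
            gcongr
            rw [← edist_eq_enorm_sub]
            exact (eVariationOn.edist_le g hxI hz).trans hgV.le
      _ = (∫⁻ z in Ioo a b, ‖f z‖ₑ) + ENNReal.ofReal (M + 1) * ENNReal.ofReal (b - a) := by
        rw [lintegral_add_right _ measurable_const, setLIntegral_const, Real.volume_Ioo]
        congr 1
        exact lintegral_congr_ae (hg.mono fun z hz => by simp only [hz])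
      _ ≤ _ := by gcongr
  rw [Real.enorm_eq_ofReal_abs, ← ENNReal.ofReal_mul (abs_nonneg _),
    ← ENNReal.ofReal_mul (by linarith), ← ENNReal.ofReal_add hM (by positivity),
    ENNReal.ofReal_le_ofReal_iff (by positivity)] at key
  rw [← mul_le_mul_iff_left₀ hba]
  calc |g x| * (b - a) ≤ M + (M + 1) * (b - a) := key
    _ = _ := by field_simp

/-! ### Quantitative injectivity on bounded intervals -/

/-- A continuous injective function controls the distance of its arguments on `[0, R]`, up to an
arbitrarily small additive error. -/
theorem exists_abs_sub_le_add_mul {w : ℝ → ℝ} (hw : Continuous w) (hinj : Function.Injective w)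
    (R : ℝ) {ε : ℝ} (hε : 0 < ε) :
    ∃ c : ℝ, 0 ≤ c ∧ ∀ r ∈ Icc 0 R, ∀ s ∈ Icc 0 R, |r - s| ≤ ε + c * |w r - w s| := by
  let S : Set (ℝ × ℝ) := (Icc 0 R ×ˢ Icc 0 R) ∩ {p | ε ≤ |p.1 - p.2|}
  have hS : IsCompact S := (isCompact_Icc.prod isCompact_Icc).inter_right
    (isClosed_le continuous_const (by fun_prop))
  rcases S.eq_empty_or_nonempty with hE | hne
  · refine ⟨0, le_rfl, fun r hr s hs => ?_⟩
    by_contra hcon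
    have : (r, s) ∈ S := ⟨⟨hr, hs⟩, by simp only [mem_ofPred_eq]; linarith⟩
    simp [hE] at this
  · obtain ⟨p, hp, hmin⟩ := hS.exists_isMinOn hne
      (f := fun p : ℝ × ℝ => |w p.1 - w p.2|) (by fun_prop)
    have hR : 0 ≤ R := hp.1.1.1.trans hp.1.1.2
    have hm : 0 < |w p.1 - w p.2| := by
      rw [abs_pos, sub_ne_zero]
      intro h
      have := hp.2
      simp only [mem_ofPred_eq, hinj h, sub_self, abs_zero] at this
      linarith
    refine ⟨R / |w p.1 - w p.2|, by positivity, fun r hr s hs => ?_⟩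
    rcases lt_or_ge |r - s| ε with h | h
    · have : 0 ≤ R / |w p.1 - w p.2| * |w r - w s| := by positivity
      linarith
    · have h1 : |w p.1 - w p.2| ≤ |w r - w s| := hmin (a := (r, s)) ⟨⟨hr, hs⟩, h⟩
      have h2 : R ≤ R / |w p.1 - w p.2| * |w r - w s| := by
        rw [div_mul_eq_mul_div, le_div_iff₀ hm]
        gcongr
      have h3 : |r - s| ≤ R := abs_sub_le_iff.2 ⟨by linarith [hr.2, hs.1], by linarith [hr.1, hs.2]⟩
      linarith

/-! ### Densities and their one-sided averages -/

/-- `u` is a Borel representative of the density of a measure of total mass `L` carried by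
`]a, b[`. -/
structure IsMassDensity (L a b : ℝ) (u : ℝ → ℝ) : Prop where
  measurable : Measurable u
  nonneg : ∀ᵐ x, 0 ≤ u x
  lintegral_eq : ∫⁻ x, ‖u x‖ₑ = ENNReal.ofReal L
  eq_zero : ∀ᵐ x, x ∉ Ioo a b → u x = 0

/-- The average of `u` over the interval of length `h` to the right of a point. -/
noncomputable def rightAverage (h : ℝ) (u : ℝ → ℝ) (x : ℝ) : ℝ :=
  h⁻¹ * ∫ y in Ioc 0 h, u (x + y)

namespace IsMassDensity

variable {L a b : ℝ} {u : ℝ → ℝ}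

theorem integrable (hu : IsMassDensity L a b u) : Integrable u :=
  ⟨hu.measurable.aestronglyMeasurable, by
    rw [HasFiniteIntegral, hu.lintegral_eq]; exact ENNReal.ofReal_lt_top⟩

theorem lintegral_translate_sub_le (hu : IsMassDensity L a b u) (y : ℝ) :
    ∫⁻ x, ‖u (x + y) - u x‖ₑ ≤ 2 * ENNReal.ofReal L := by
  calc ∫⁻ x, ‖u (x + y) - u x‖ₑ ≤ ∫⁻ x, (‖u (x + y)‖ₑ + ‖u x‖ₑ) :=
        lintegral_mono fun x => enorm_sub_le
    _ = (∫⁻ x, ‖u (x + y)‖ₑ) + ∫⁻ x, ‖u x‖ₑ := lintegral_add_right _ hu.measurable.enorm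
    _ = 2 * ENNReal.ofReal L := by
      rw [lintegral_add_right_eq_self (fun x => ‖u x‖ₑ) y, hu.lintegral_eq, two_mul]

/-- Translation estimate for a density bounded by `R`. Where both points lie in `]a, b[`, the modulus
of injectivity of `w` transfers the estimate from `w ∘ u` to `u`; the last term accounts for the two
layers of width `y` at the boundary, across which `u` may jump. -/
theorem lintegral_translate_sub_le_of_le (hu : IsMassDensity L a b u) {w : ℝ → ℝ} {R ε c : ℝ}
    (hR : ∀ᵐ x, u x ≤ R) (hε : 0 ≤ ε) (hc : 0 ≤ c)
    (hmod : ∀ r ∈ Icc 0 R, ∀ s ∈ Icc 0 R, |r - s| ≤ ε + c * |w r - w s|)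
    {y : ℝ} (hy : 0 < y) :
    ∫⁻ x, ‖u (x + y) - u x‖ₑ ≤
      ENNReal.ofReal ε * ENNReal.ofReal (b - a) +
        ENNReal.ofReal c * (ENNReal.ofReal y * essVariation (fun x => w (u x)) (Ioo a b)) +
        2 * (ENNReal.ofReal R * ENNReal.ofReal y) := by
  -- `f₁` lives on the interior, `f₂` and `f₃` on the two boundary layers
  let f₁ : ℝ → ENNReal := (Ioo a (b - y)).indicator fun x =>
    ENNReal.ofReal ε + ENNReal.ofReal c * ‖w (u (x + y)) - w (u x)‖ₑ
  let f₂ : ℝ → ENNReal := (Icc (a - y) a).indicator fun _ => ENNReal.ofReal R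
  let f₃ : ℝ → ENNReal := (Icc (b - y) b).indicator fun _ => ENNReal.ofReal R
  have hf₂ : Measurable f₂ := measurable_const.indicator measurableSet_Icc
  have hf₃ : Measurable f₃ := measurable_const.indicator measurableSet_Icc
  have hq := quasiMeasurePreserving_add_right (volume : Measure ℝ) y
  have hpt : ∀ᵐ x, ‖u (x + y) - u x‖ₑ ≤ f₁ x + f₂ x + f₃ x := by
    filter_upwards [hu.nonneg, hR, hu.eq_zero, hq.ae hu.nonneg, hq.ae hR, hq.ae hu.eq_zero]
      with x h0 h1 h2 k0 k1 k2
    by_cases hx : x ∈ Ioo a (b - y)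
    · refine le_trans ?_ (le_self_add.trans le_self_add)
      simp only [f₁, indicator_of_mem hx]
      rw [Real.enorm_eq_ofReal_abs, Real.enorm_eq_ofReal_abs, ← ENNReal.ofReal_mul hc,
        ← ENNReal.ofReal_add hε (by positivity)]
      exact ENNReal.ofReal_le_ofReal (hmod _ ⟨k0, k1⟩ _ ⟨h0, h1⟩)
    rcases le_or_gt x a with hxa | hxa
    · rw [h2 fun h => by linarith [h.1], sub_zero]
      rcases lt_or_ge x (a - y) with hxy | hxy
      · rw [k2 fun h => by linarith [h.1], enorm_zero]
        exact zero_le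
      · refine le_trans ?_ (le_add_self.trans le_self_add)
        simp only [f₂, indicator_of_mem (show x ∈ Icc (a - y) a from ⟨hxy, hxa⟩)]
        rw [Real.enorm_of_nonneg k0]
        exact ENNReal.ofReal_le_ofReal k1
    · have hxb : b - y ≤ x := not_lt.1 fun h => hx ⟨hxa, h⟩
      rw [k2 fun h => by linarith [h.2], zero_sub, enorm_neg]
      rcases lt_or_ge b x with hxy | hxy
      · rw [h2 fun h => by linarith [h.2], enorm_zero]
        exact zero_le
      · refine le_trans ?_ le_add_self
        simp only [f₃, indicator_of_mem (show x ∈ Icc (b - y) b from ⟨hxb, hxy⟩)]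
        rw [Real.enorm_of_nonneg h0]
        exact ENNReal.ofReal_le_ofReal h1
  have e₁ : ∫⁻ x, f₁ x ≤ ENNReal.ofReal ε * ENNReal.ofReal (b - a) +
      ENNReal.ofReal c * (ENNReal.ofReal y * essVariation (fun x => w (u x)) (Ioo a b)) := by
    simp only [f₁]
    rw [lintegral_indicator measurableSet_Ioo, lintegral_add_left measurable_const,
      lintegral_const_mul' _ _ ENNReal.ofReal_ne_top, setLIntegral_const, Real.volume_Ioo]
    gcongr
    · linarith
    · exact lintegral_translate_sub_le_essVariation (fun x => w (u x)) a b hy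
  have e₂ : ∫⁻ x, f₂ x = ENNReal.ofReal R * ENNReal.ofReal y := by
    simp only [f₂]
    rw [lintegral_indicator measurableSet_Icc, setLIntegral_const, Real.volume_Icc, sub_sub_cancel]
  have e₃ : ∫⁻ x, f₃ x = ENNReal.ofReal R * ENNReal.ofReal y := by
    simp only [f₃]
    rw [lintegral_indicator measurableSet_Icc, setLIntegral_const, Real.volume_Icc, sub_sub_cancel]
  calc ∫⁻ x, ‖u (x + y) - u x‖ₑ ≤ ∫⁻ x, (f₁ x + f₂ x + f₃ x) := lintegral_mono_ae hpt
    _ = (∫⁻ x, f₁ x) + (∫⁻ x, f₂ x) + ∫⁻ x, f₃ x := by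
      rw [lintegral_add_right _ hf₃, lintegral_add_right _ hf₂]
    _ ≤ _ := by
      rw [e₂, e₃, add_assoc, ← two_mul]
      gcongr

/-- The distance of `u` to its average is at most the mean of its distances to its translates. -/
theorem lintegral_sub_rightAverage_le (hu : IsMassDensity L a b u) {h : ℝ} (hh : 0 < h)
    {B : ENNReal} (hB : ∀ y ∈ Ioc 0 h, ∫⁻ x, ‖u (x + y) - u x‖ₑ ≤ B) :
    ∫⁻ x, ‖u x - rightAverage h u x‖ₑ ≤ B := by
  have hpt : ∀ x, ‖u x - rightAverage h u x‖ₑ ≤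
      ENNReal.ofReal h⁻¹ * ∫⁻ y in Ioc 0 h, ‖u (x + y) - u x‖ₑ := by
    intro x
    have hint : IntegrableOn (fun y => u (x + y)) (Ioc 0 h) :=
      (hu.integrable.comp_add_left x).integrableOn
    have : rightAverage h u x - u x = h⁻¹ * ∫ y in Ioc 0 h, (u (x + y) - u x) := by
      rw [integral_sub hint (integrable_const _), rightAverage]
      simp [hh.le]
      field_simp
    rw [← enorm_neg, neg_sub, this, enorm_mul, Real.enorm_of_nonneg (inv_nonneg.2 hh.le)]
    gcongr
    exact enorm_integral_le_lintegral_enorm _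
  have hmeas : Measurable (Function.uncurry fun x y : ℝ => ‖u (x + y) - u x‖ₑ) := by
    have := hu.measurable
    unfold Function.uncurry
    fun_prop
  calc ∫⁻ x, ‖u x - rightAverage h u x‖ₑ
      ≤ ∫⁻ x, ENNReal.ofReal h⁻¹ * ∫⁻ y in Ioc 0 h, ‖u (x + y) - u x‖ₑ := lintegral_mono hpt
    _ = ENNReal.ofReal h⁻¹ * ∫⁻ y in Ioc 0 h, ∫⁻ x, ‖u (x + y) - u x‖ₑ := by
      rw [lintegral_const_mul' _ _ ENNReal.ofReal_ne_top,
        lintegral_lintegral_swap hmeas.aemeasurable]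
    _ ≤ ENNReal.ofReal h⁻¹ * ∫⁻ _ in Ioc 0 h, B := by
      gcongr ENNReal.ofReal h⁻¹ * ?_
      exact setLIntegral_mono' measurableSet_Ioc hB
    _ = B := by
      rw [setLIntegral_const, Real.volume_Ioc, sub_zero, mul_left_comm,
        ← ENNReal.ofReal_mul (by positivity), inv_mul_cancel₀ hh.ne', ENNReal.ofReal_one, mul_one]

theorem cumul_densityMeasure (hu : IsMassDensity L a b u) (x : ℝ) :
    cumul (densityMeasure u) x = ∫ y in Iic x, u y := by
  rw [cumul, densityMeasure, Measure.real, withDensity_apply _ measurableSet_Iic,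
    integral_eq_lintegral_of_nonneg_ae (ae_restrict_of_ae hu.nonneg)
      hu.measurable.aestronglyMeasurable]

theorem rightAverage_eq (hu : IsMassDensity L a b u) {h : ℝ} (hh : 0 < h) (x : ℝ) :
    rightAverage h u x =
      h⁻¹ * (cumul (densityMeasure u) (x + h) - cumul (densityMeasure u) x) := by
  rw [hu.cumul_densityMeasure, hu.cumul_densityMeasure,
    intervalIntegral.integral_Iic_sub_Iic hu.integrable.integrableOn hu.integrable.integrableOn,
    rightAverage, ← intervalIntegral.integral_of_le hh.le,
    intervalIntegral.integral_comp_add_left u x, add_zero]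

end IsMassDensity

theorem monotone_cumul (μ : Measure ℝ) [IsFiniteMeasure μ] : Monotone (cumul μ) :=
  fun _ _ h => measureReal_mono (Iic_subset_Iic.2 h)

theorem measurable_cumul (μ : Measure ℝ) [IsFiniteMeasure μ] : Measurable (cumul μ) :=
  (monotone_cumul μ).measurable

theorem scaledW1_eq_lintegral (μ ν : Measure ℝ) :
    scaledW1 μ ν = ∫⁻ x, ‖cumul μ x - cumul ν x‖ₑ :=
  eLpNorm_one_eq_lintegral_enorm

theorem scaledW1_triangle (μ ν τ : Measure ℝ) [IsFiniteMeasure ν] [IsFiniteMeasure τ] :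
    scaledW1 μ τ ≤ scaledW1 μ ν + scaledW1 ν τ := by
  simp only [scaledW1_eq_lintegral]
  have hm : Measurable fun x => ‖cumul ν x - cumul τ x‖ₑ :=
    ((measurable_cumul ν).sub (measurable_cumul τ)).enorm
  rw [← lintegral_add_right _ hm]
  refine lintegral_mono fun x => ?_
  rw [← sub_add_sub_cancel (cumul μ x) (cumul ν x)]
  exact enorm_add_le _ _

/-- An average is a difference quotient of the distribution function, hence Lipschitz in `L¹` with
respect to the scaled Wasserstein distance. -/
theorem lintegral_rightAverage_sub_le {L a b : ℝ} {u v : ℝ → ℝ} (hu : IsMassDensity L a b u)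
    (hv : IsMassDensity L a b v) [IsFiniteMeasure (densityMeasure u)]
    [IsFiniteMeasure (densityMeasure v)] {h : ℝ} (hh : 0 < h) :
    ∫⁻ x, ‖rightAverage h u x - rightAverage h v x‖ₑ ≤
      ENNReal.ofReal h⁻¹ * (2 * scaledW1 (densityMeasure u) (densityMeasure v)) := by
  set D : ℝ → ℝ := fun x => cumul (densityMeasure u) x - cumul (densityMeasure v) x with hD
  have hDm : Measurable D := (measurable_cumul _).sub (measurable_cumul _)
  have hpt : ∀ x, ‖rightAverage h u x - rightAverage h v x‖ₑ ≤
      ENNReal.ofReal h⁻¹ * (‖D (x + h)‖ₑ + ‖D x‖ₑ) := by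
    intro x
    have : rightAverage h u x - rightAverage h v x = h⁻¹ * (D (x + h) - D x) := by
      rw [hu.rightAverage_eq hh, hv.rightAverage_eq hh]
      simp only [hD]
      ring
    rw [this, enorm_mul, Real.enorm_of_nonneg (inv_nonneg.2 hh.le)]
    gcongr
    exact enorm_sub_le
  refine (lintegral_mono hpt).trans_eq ?_
  rw [lintegral_const_mul' _ _ ENNReal.ofReal_ne_top, lintegral_add_right _ hDm.enorm,
    lintegral_add_right_eq_self (fun x => ‖D x‖ₑ) h, ← two_mul, scaledW1_eq_lintegral]

/-! ### Discretization of the scaled Wasserstein distance -/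

theorem isFiniteMeasure_of_mem_massClass {L : ℝ} {μ : Measure ℝ} (h : μ ∈ massClass L) :
    IsFiniteMeasure μ :=
  ⟨by rw [h.2]; exact ENNReal.ofReal_lt_top⟩

theorem measure_compl_eq_zero_of_support_subset {μ : Measure ℝ} {s : Set ℝ} (h : μ.support ⊆ s) :
    μ sᶜ = 0 :=
  measure_mono_null (compl_subset_compl.2 h) Measure.measure_compl_support

theorem cumul_eq_zero {μ : Measure ℝ} {a b x : ℝ} (h : μ.support ⊆ Ioo a b) (hx : x ≤ a) :
    cumul μ x = 0 := by
  have : μ (Iic x) = 0 := measure_mono_null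
    (show Iic x ⊆ (Ioo a b)ᶜ from fun y hy hy' => not_lt.2 (le_trans hy hx) hy'.1)
    (measure_compl_eq_zero_of_support_subset h)
  simp [cumul, Measure.real, this]

theorem cumul_eq_of_le {μ : Measure ℝ} {L a b x : ℝ} (hL : 0 ≤ L) (hμ : μ ∈ massClass L)
    (h : μ.support ⊆ Ioo a b) (hx : b ≤ x) : cumul μ x = L := by
  have h0 : μ (Iic x)ᶜ = 0 := measure_mono_null
    (show (Iic x)ᶜ ⊆ (Ioo a b)ᶜ from fun y hy hy' => hy (hy'.2.le.trans hx)) (measure_compl_eq_zero_of_support_subset h)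
  have h1 : μ (Iic x) = μ univ := measure_congr (by rwa [ae_eq_univ])
  rw [cumul, Measure.real, h1, hμ.2, ENNReal.toReal_ofReal hL]

theorem cumul_mem_Icc {μ : Measure ℝ} {L : ℝ} (hL : 0 ≤ L) (hμ : μ ∈ massClass L) (x : ℝ) :
    cumul μ x ∈ Icc 0 L := by
  have := isFiniteMeasure_of_mem_massClass hμ
  refine ⟨measureReal_nonneg, ?_⟩
  calc cumul μ x ≤ μ.real univ := measureReal_mono (subset_univ _)
    _ = L := by rw [Measure.real, hμ.2, ENNReal.toReal_ofReal hL]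

/-- The distribution functions being monotone, their values on a fine grid control the scaled
Wasserstein distance. -/
theorem scaledW1_le_of_grid {μ ν : Measure ℝ} {L a b d η : ℝ} (hL : 0 ≤ L)
    (hμ : μ ∈ massClass L) (hν : ν ∈ massClass L) (hμs : μ.support ⊆ Ioo a b)
    (hνs : ν.support ⊆ Ioo a b) (hd : 0 < d) (hd1 : d ≤ 1) (hη : 0 ≤ η) {X : Set ℝ}
    (hX : ∀ z ∈ Icc (a - 1) (b + 1), ∃ p ∈ X, |z - p| < d)
    (hgrid : ∀ p ∈ X, |cumul μ p - cumul ν p| ≤ η) :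
    scaledW1 μ ν ≤ ENNReal.ofReal η * ENNReal.ofReal (b - a) +
      ENNReal.ofReal (4 * d) * ENNReal.ofReal L := by
  have := isFiniteMeasure_of_mem_massClass hμ
  have := isFiniteMeasure_of_mem_massClass hν
  have hF := monotone_cumul μ
  have hG := monotone_cumul ν
  -- shifted so that the oscillation on `[x - 2 d, x + 2 d]` is the increment `g (x + 4 d) - g x`
  let g : ℝ → ℝ := fun x => cumul μ (x - 2 * d)
  have hg : Monotone g := fun x y hxy => hF (by linarith)
  have hpt : ∀ x, ‖cumul μ x - cumul ν x‖ₑ ≤ (Ioo a b).indicator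
      (fun x => ENNReal.ofReal η + ‖g (x + 4 * d) - g x‖ₑ) x := by
    intro x
    by_cases hx : x ∈ Ioo a b
    · rw [indicator_of_mem hx]
      -- both distribution functions are compared at grid points `p ≤ x ≤ q` at distance `< 2 d`
      obtain ⟨p, hp, hpx⟩ := hX (x - d) ⟨by linarith [hx.1], by linarith [hx.2]⟩
      obtain ⟨q, hq, hqx⟩ := hX (x + d) ⟨by linarith [hx.1], by linarith [hx.2]⟩
      rw [abs_lt] at hpx hqx
      have gp := abs_le.1 (hgrid p hp)
      have gq := abs_le.1 (hgrid q hq)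
      have h1 := hF (show p ≤ x by linarith)
      have h2 := hF (show x ≤ q by linarith)
      have h3 := hG (show p ≤ x by linarith)
      have h4 := hG (show x ≤ q by linarith)
      have h5 := hF (show x - 2 * d ≤ p by linarith)
      have h6 := hF (show q ≤ x + 4 * d - 2 * d by linarith)
      have h7 : 0 ≤ g (x + 4 * d) - g x := sub_nonneg.2 (hg (by linarith))
      rw [Real.enorm_of_nonneg h7, ← ENNReal.ofReal_add hη h7, Real.enorm_eq_ofReal_abs]
      refine ENNReal.ofReal_le_ofReal (abs_le.2 ?_)
      simp only [g]
      constructor <;> linarith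
    · rw [indicator_of_notMem hx]
      rcases le_or_gt x a with hxa | hxa
      · simp [cumul_eq_zero hμs hxa, cumul_eq_zero hνs hxa]
      · have hxb : b ≤ x := not_lt.1 fun h => hx ⟨hxa, h⟩
        simp [cumul_eq_of_le hL hμ hμs hxb, cumul_eq_of_le hL hν hνs hxb]
  have hvar : eVariationOn g (Ioo a (b + 4 * d)) ≤ ENNReal.ofReal L := by
    rcases le_or_gt a (b + 4 * d) with hab | hab
    · refine (eVariationOn.mono g (s := univ ∩ Icc a (b + 4 * d)) ?_).trans ?_
      · rw [univ_inter]
        exact Ioo_subset_Icc_self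
      · rw [(hg.monotoneOn univ).eVariationOn_eq (mem_univ _) (mem_univ _)]
        refine ENNReal.ofReal_le_ofReal ?_
        simp only [g]
        linarith [(cumul_mem_Icc hL hμ (b + 4 * d - 2 * d)).2, (cumul_mem_Icc hL hμ (a - 2 * d)).1]
    · simp [Ioo_eq_empty (not_lt.2 hab.le)]
  rw [scaledW1_eq_lintegral]
  refine (lintegral_mono hpt).trans ?_
  rw [lintegral_indicator measurableSet_Ioo, lintegral_add_left measurable_const,
    setLIntegral_const, Real.volume_Ioo]
  gcongr
  have := lintegral_translate_sub_le g a (b + 4 * d) (y := 4 * d) (by linarith)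
  rw [add_sub_cancel_right] at this
  exact this.trans (by gcongr)

/-- Finitely many indices suffice to approximate the whole sequence in the scaled Wasserstein
distance, uniformly in time. -/
theorem exists_finite_forall_scaledW1_le {T L a b : ℝ} (hL : 0 ≤ L) {μ : ℕ → ℝ → Measure ℝ}
    (hμ : ∀ n, ∀ t ∈ Ioo 0 T, μ n t ∈ massClass L)
    (hsupp : ∀ n, ∀ t ∈ Ioo 0 T, (μ n t).support ⊆ Ioo a b) {C : NNReal}
    (hC : ∀ n, ∀ s ∈ Ioo 0 T, ∀ t ∈ Ioo 0 T,
      scaledW1 (μ n s) (μ n t) ≤ C * ENNReal.ofReal |t - s|) {δ : ℝ} (hδ : 0 < δ) :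
    ∃ S : Set ℕ, S.Finite ∧ ∀ n, ∃ m ∈ S, ∀ t ∈ Ioo 0 T,
      scaledW1 (μ n t) (μ m t) ≤ ENNReal.ofReal δ := by
  have hC0 : (0 : ℝ) ≤ C := C.2
  obtain ⟨τ, hτ0, hτ⟩ : ∃ τ : ℝ, 0 < τ ∧ C * τ ≤ δ / 4 :=
    ⟨δ / (4 * (C + 1)), by positivity, by
      rw [mul_div_assoc', div_le_div_iff₀ (by positivity) (by norm_num)]; nlinarith⟩
  obtain ⟨d, hd0, hd1, hd⟩ : ∃ d : ℝ, 0 < d ∧ d ≤ 1 ∧ 4 * d * L ≤ δ / 4 :=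
    ⟨min 1 (δ / (16 * (L + 1))), by positivity, min_le_left _ _, by
      have h1 : min 1 (δ / (16 * (L + 1))) ≤ δ / (16 * (L + 1)) := min_le_right _ _
      have h2 : δ / (16 * (L + 1)) * (16 * (L + 1)) = δ := by field_simp
      have h3 : 0 < δ / (16 * (L + 1)) := by positivity
      nlinarith⟩
  obtain ⟨η, hη0, hη⟩ : ∃ η : ℝ, 0 < η ∧ η * max (b - a) 0 ≤ δ / 4 :=
    ⟨δ / (4 * (max (b - a) 0 + 1)), by positivity, by
      have : 0 ≤ max (b - a) 0 := le_max_right _ _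
      rw [div_mul_eq_mul_div, div_le_div_iff₀ (by positivity) (by norm_num)]; nlinarith⟩
  -- `Θ` is a grid in time and `X` a grid in space; the values of the distribution functions on
  -- `Θ × X` form a bounded, hence totally bounded, set of a finite-dimensional space
  obtain ⟨Θ, hΘs, hΘf, hΘ⟩ := Metric.finite_approx_of_totallyBounded
    ((isCompact_Icc (a := (0 : ℝ)) (b := T)).totallyBounded.subset Ioo_subset_Icc_self) τ hτ0
  obtain ⟨X, -, hXf, hX⟩ := Metric.finite_approx_of_totallyBounded
    (isCompact_Icc (a := a - 1) (b := b + 1)).totallyBounded d hd0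
  have := hΘf.fintype
  have := hXf.fintype
  let κ : ℕ → (Θ × X → ℝ) := fun n q => cumul (μ n q.1) q.2
  have hκ : TotallyBounded (range κ) := by
    refine (isCompact_univ_pi fun _ : Θ × X => isCompact_Icc (a := 0) (b := L)).totallyBounded.subset
      ?_
    rintro _ ⟨n, rfl⟩ q -
    exact cumul_mem_Icc hL (hμ n _ (hΘs q.1.2)) _
  obtain ⟨Y, hYs, hYf, hY⟩ := Metric.finite_approx_of_totallyBounded hκ η hη0
  refine ⟨Function.invFun κ '' Y, hYf.image _, fun n => ?_⟩
  obtain ⟨y, hyY, hy⟩ := mem_iUnion₂.1 (hY (mem_range_self n))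
  refine ⟨_, mem_image_of_mem _ hyY, fun t ht => ?_⟩
  set m := Function.invFun κ y
  have hm : κ m = y := Function.invFun_eq (hYs hyY)
  rw [← hm, Metric.mem_ball] at hy
  obtain ⟨s, hsΘ, hs⟩ := mem_iUnion₂.1 (hΘ ht)
  rw [Metric.mem_ball, Real.dist_eq] at hs
  have hsT := hΘs hsΘ
  have hfin : ∀ k, ∀ r ∈ Ioo 0 T, IsFiniteMeasure (μ k r) :=
    fun k r hr => isFiniteMeasure_of_mem_massClass (hμ k r hr)
  have := hfin n s hsT
  have := hfin m s hsT
  have := hfin m t ht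
  have hgrid := scaledW1_le_of_grid hL (hμ n s hsT) (hμ m s hsT) (hsupp n s hsT) (hsupp m s hsT)
    hd0 hd1 hη0.le (X := X)
    (fun z hz => by
      obtain ⟨p, hp, hzp⟩ := mem_iUnion₂.1 (hX hz)
      exact ⟨p, hp, by rwa [Metric.mem_ball, Real.dist_eq] at hzp⟩)
    (fun p hp => by
      have := (dist_le_pi_dist (κ n) (κ m) (⟨s, hsΘ⟩, ⟨p, hp⟩)).trans hy.le
      rwa [Real.dist_eq] at this)
  have htime : ∀ r r' : ℝ, |r' - r| < τ → (C : ENNReal) * ENNReal.ofReal |r' - r| ≤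
      ENNReal.ofReal (δ / 4) := by
    intro r r' h
    rw [← ENNReal.ofReal_coe_nnreal, ← ENNReal.ofReal_mul hC0]
    exact ENNReal.ofReal_le_ofReal ((mul_le_mul_of_nonneg_left h.le hC0).trans hτ)
  calc scaledW1 (μ n t) (μ m t)
      ≤ scaledW1 (μ n t) (μ n s) + (scaledW1 (μ n s) (μ m s) + scaledW1 (μ m s) (μ m t)) :=
        (scaledW1_triangle _ (μ n s) _).trans (by gcongr; exact scaledW1_triangle _ _ _)
    _ ≤ ENNReal.ofReal (δ / 4) + ((ENNReal.ofReal (δ / 4) + ENNReal.ofReal (δ / 4)) +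
        ENNReal.ofReal (δ / 4)) := by
      gcongr
      · exact (hC n t ht s hsT).trans (htime _ _ (by rwa [abs_sub_comm]))
      · refine hgrid.trans (add_le_add ?_ ?_)
        · rw [← ENNReal.ofReal_mul hη0.le]
          refine ENNReal.ofReal_le_ofReal (le_trans ?_ hη)
          gcongr
          exact le_max_left _ _
        · rw [← ENNReal.ofReal_mul (by positivity)]
          exact ENNReal.ofReal_le_ofReal hd
      · exact (hC m s hsT t ht).trans (htime _ _ hs)
    _ = ENNReal.ofReal δ := by
      have h4 : 0 ≤ δ / 4 := by positivity
      rw [← ENNReal.ofReal_add h4 h4, ← ENNReal.ofReal_add (by positivity) h4,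
        ← ENNReal.ofReal_add h4 (by positivity)]
      congr 1
      ring

/-! ### Distance to the averages, integrated in time -/

/-- The `W^{1,1}`-type quantity `‖w ∘ u‖_{L¹(I)} + TV[w ∘ u; I]`, for `I = ]a, b[`. -/
noncomputable def bvNorm (w : ℝ → ℝ) (a b : ℝ) (u : ℝ → ℝ) : ENNReal :=
  eLpNorm (fun x => w (u x)) 1 (volume.restrict (Ioo a b)) +
    essVariation (fun x => w (u x)) (Ioo a b)

theorem bvNorm_congr {w : ℝ → ℝ} {a b : ℝ} {u v : ℝ → ℝ} (h : u =ᵐ[volume] v) :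
    bvNorm w a b u = bvNorm w a b v := by
  have h' : (fun x => w (u x)) =ᵐ[volume.restrict (Ioo a b)] fun x => w (v x) :=
    ae_restrict_of_ae (h.mono fun x hx => by simp only [hx])
  rw [bvNorm, bvNorm, eLpNorm_congr_ae h', essVariation_congr h']

theorem isMassDensity_of_mem_massClass {L a b : ℝ} {u : ℝ → ℝ} (hm : Measurable u)
    (h0 : ∀ᵐ x, 0 ≤ u x) (hμ : densityMeasure u ∈ massClass L)
    (hs : (densityMeasure u).support ⊆ Ioo a b) : IsMassDensity L a b u where
  measurable := hm
  nonneg := h0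
  lintegral_eq := by
    rw [← hμ.2, densityMeasure, withDensity_apply _ MeasurableSet.univ, Measure.restrict_univ]
    exact lintegral_congr_ae (h0.mono fun x hx => Real.enorm_of_nonneg hx)
  eq_zero := by
    have h := measure_compl_eq_zero_of_support_subset hs
    rw [densityMeasure, withDensity_apply _ measurableSet_Ioo.compl,
      lintegral_eq_zero_iff hm.ennreal_ofReal, EventuallyEq,
      ae_restrict_iff' measurableSet_Ioo.compl] at h
    filter_upwards [h, h0] with x hx hx0 hxI
    exact le_antisymm (ENNReal.ofReal_eq_zero.1 (hx hxI)) hx0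

/-- When `|w|` is coercive at `+∞`, a bound on `bvNorm` gives an `L^∞` bound. -/
theorem IsMassDensity.exists_le_of_bvNorm_le {L a b : ℝ} (hab : a < b) {w : ℝ → ℝ}
    (hw : Tendsto (fun r => |w r|) atTop atTop) {M : ℝ} (hM : 0 ≤ M) :
    ∃ R : ℝ, ∀ u, IsMassDensity L a b u → bvNorm w a b u ≤ ENNReal.ofReal M →
      ∀ᵐ x, u x ≤ R := by
  obtain ⟨R, hR⟩ := eventually_atTop.1 (hw.eventually_gt_atTop (M / (b - a) + (M + 1)))
  refine ⟨max R 0, fun u hu hb => ?_⟩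
  have h1 := ae_abs_le_of_essVariation_le hab hM hb
  rw [ae_restrict_iff' measurableSet_Ioo] at h1
  filter_upwards [h1, hu.eq_zero] with x hx hx0
  by_cases hxI : x ∈ Ioo a b
  · by_contra! hcon
    exact absurd (hR (u x) ((le_max_left _ _).trans hcon.le)) (not_lt.2 (hx hxI))
  · rw [hx0 hxI]
    exact le_max_right _ _

/-- Distance to the average, linear in `bvNorm` so that it can be integrated in time.
For densities with `bvNorm` at most `M` the bound comes from the modulus of injectivity of `w`
on `[0, R]`; for the others the trivial bound `2 L` is at most `(2 L / M) * bvNorm`. -/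
theorem IsMassDensity.lintegral_sub_rightAverage_le_bvNorm {L a b : ℝ} {u : ℝ → ℝ}
    (hu : IsMassDensity L a b u) {w : ℝ → ℝ} {M R ε c : ℝ} (hM : 0 < M)
    (hR : bvNorm w a b u ≤ ENNReal.ofReal M → ∀ᵐ x, u x ≤ R) (hε : 0 ≤ ε) (hc : 0 ≤ c)
    (hmod : ∀ r ∈ Icc 0 R, ∀ s ∈ Icc 0 R, |r - s| ≤ ε + c * |w r - w s|)
    {h : ℝ} (hh : 0 < h) :
    ∫⁻ x, ‖u x - rightAverage h u x‖ₑ ≤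
      (2 * ENNReal.ofReal L / ENNReal.ofReal M + ENNReal.ofReal c * ENNReal.ofReal h) *
          bvNorm w a b u +
        (ENNReal.ofReal ε * ENNReal.ofReal (b - a) +
          2 * (ENNReal.ofReal R * ENNReal.ofReal h)) := by
  rw [add_mul]
  rcases le_or_gt (bvNorm w a b u) (ENNReal.ofReal M) with hle | hgt
  · refine (hu.lintegral_sub_rightAverage_le hh fun y hy =>
      (hu.lintegral_translate_sub_le_of_le (hR hle) hε hc hmod hy.1).trans
        (?_ : _ ≤ ENNReal.ofReal c * ENNReal.ofReal h * bvNorm w a b u +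
          (ENNReal.ofReal ε * ENNReal.ofReal (b - a) +
            2 * (ENNReal.ofReal R * ENNReal.ofReal h)))).trans ?_
    · rw [← add_assoc, add_comm (ENNReal.ofReal ε * _), mul_assoc]
      have := hy.2
      gcongr
      exact le_add_self
    · gcongr
      exact le_add_self
  · refine le_trans ?_ (le_self_add.trans le_self_add)
    refine (hu.lintegral_sub_rightAverage_le hh fun y _ => hu.lintegral_translate_sub_le y).trans ?_
    calc 2 * ENNReal.ofReal L = 2 * ENNReal.ofReal L / ENNReal.ofReal M * ENNReal.ofReal M :=
          (ENNReal.div_mul_cancel (by simpa using hM) ENNReal.ofReal_ne_top).symm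
      _ ≤ _ := by gcongr

/-- The averages over a small length approximate the sequence in `L¹` of the strip, uniformly in
the index. Only monotonicity of the lower integral is used, so the measurability of
`t ↦ bvNorm w a b (r n t)` plays no role. -/
theorem exists_lintegral_sub_rightAverage_le {T L a b : ℝ} (hT : 0 < T) (hL : 0 ≤ L)
    {w : ℝ → ℝ} (hw : Continuous w) (hinj : Function.Injective w) {r : ℕ → ℝ → ℝ → ℝ}
    (hr : ∀ n, ∀ᵐ t ∂volume.restrict (Ioo 0 T), IsMassDensity L a b (r n t))
    (hR : ∀ M : ℝ, 0 < M → ∃ R : ℝ, ∀ n, ∀ᵐ t ∂volume.restrict (Ioo 0 T),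
      bvNorm w a b (r n t) ≤ ENNReal.ofReal M → ∀ᵐ x, r n t x ≤ R)
    {K : NNReal} (hK : ∀ n, ∫⁻ t in Ioo 0 T, bvNorm w a b (r n t) ≤ K) {δ : ℝ} (hδ : 0 < δ) :
    ∃ h : ℝ, 0 < h ∧ ∀ n,
      ∫⁻ t in Ioo 0 T, ∫⁻ x, ‖r n t x - rightAverage h (r n t) x‖ₑ ≤ ENNReal.ofReal δ := by
  have hK0 : (0 : ℝ) ≤ K := K.2
  obtain ⟨M, hM0, hM⟩ : ∃ M : ℝ, 0 < M ∧ 2 * L / M * K ≤ δ / 4 :=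
    ⟨8 * (L + 1) * (K + 1) / δ, by positivity, by
      rw [show 2 * L / (8 * (L + 1) * (K + 1) / δ) * K = δ / 4 * (L / (L + 1) * (K / (K + 1))) by
        field_simp; ring]
      have h1 : L / (L + 1) ≤ 1 := (div_le_one (by positivity)).2 (by linarith)
      have h2 : (K : ℝ) / (K + 1) ≤ 1 := (div_le_one (by positivity)).2 (by linarith)
      exact mul_le_of_le_one_right (by positivity) (mul_le_one₀ h1 (by positivity) h2)⟩
  -- the order of choice matters: `R` depends on `M`, then `c` on `R` and `ε`, then `h` on all
  obtain ⟨R, hR⟩ := hR M hM0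
  set R' := max R 0
  have hR' : 0 ≤ R' := le_max_right _ _
  set ℓ := max (b - a) 0
  have hℓ : 0 ≤ ℓ := le_max_right _ _
  obtain ⟨ε, hε0, hε⟩ : ∃ ε : ℝ, 0 < ε ∧ ε * ℓ * T ≤ δ / 4 :=
    ⟨δ / (4 * (ℓ * T + 1)), by positivity, by
      have : 0 ≤ ℓ * T := by positivity
      rw [mul_assoc, div_mul_eq_mul_div, div_le_div_iff₀ (by positivity) (by norm_num)]
      nlinarith⟩
  obtain ⟨c, hc, hmod⟩ := exists_abs_sub_le_add_mul hw hinj R' hε0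
  obtain ⟨h, hh, hhδ⟩ : ∃ h : ℝ, 0 < h ∧ c * h * K + 2 * (R' * h) * T ≤ δ / 4 :=
    ⟨δ / (4 * (c * K + 2 * R' * T + 1)), by positivity, by
      have : 0 ≤ c * K + 2 * R' * T := by positivity
      rw [show ∀ h : ℝ, c * h * K + 2 * (R' * h) * T = h * (c * K + 2 * R' * T) by intro h; ring,
        div_mul_eq_mul_div, div_le_div_iff₀ (by positivity) (by norm_num)]
      nlinarith⟩
  refine ⟨h, hh, fun n => ?_⟩
  have hpt : ∀ᵐ t ∂volume.restrict (Ioo 0 T), ∫⁻ x, ‖r n t x - rightAverage h (r n t) x‖ₑ ≤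
      ENNReal.ofReal (2 * L / M + c * h) * bvNorm w a b (r n t) +
        ENNReal.ofReal (ε * ℓ + 2 * (R' * h)) := by
    filter_upwards [hr n, hR n] with t ht htR
    refine (ht.lintegral_sub_rightAverage_le_bvNorm hM0
      (fun hb => (htR hb).mono fun x hx => hx.trans (le_max_left R 0)) hε0.le hc hmod hh).trans ?_
    rw [ENNReal.ofReal_add (by positivity) (by positivity), ENNReal.ofReal_div_of_pos hM0,
      ENNReal.ofReal_mul zero_le_two, ENNReal.ofReal_mul hc,
      ENNReal.ofReal_add (by positivity) (by positivity), ENNReal.ofReal_mul hε0.le,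
      ENNReal.ofReal_mul zero_le_two, ENNReal.ofReal_mul hR', ENNReal.ofReal_ofNat]
    gcongr
    exact le_max_left _ _
  calc ∫⁻ t in Ioo 0 T, ∫⁻ x, ‖r n t x - rightAverage h (r n t) x‖ₑ
      ≤ ∫⁻ t in Ioo 0 T, (ENNReal.ofReal (2 * L / M + c * h) * bvNorm w a b (r n t) +
        ENNReal.ofReal (ε * ℓ + 2 * (R' * h))) := lintegral_mono_ae hpt
    _ ≤ ENNReal.ofReal (2 * L / M + c * h) * ENNReal.ofReal K +
        ENNReal.ofReal (ε * ℓ + 2 * (R' * h)) * ENNReal.ofReal T := by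
      rw [lintegral_add_right _ measurable_const, lintegral_const_mul' _ _ ENNReal.ofReal_ne_top,
        setLIntegral_const, Real.volume_Ioo, sub_zero, ENNReal.ofReal_coe_nnreal]
      gcongr
      exact hK n
    _ ≤ ENNReal.ofReal δ := by
      rw [← ENNReal.ofReal_mul (by positivity), ← ENNReal.ofReal_mul (by positivity),
        ← ENNReal.ofReal_add (by positivity) (by positivity)]
      exact ENNReal.ofReal_le_ofReal (by linarith)

/-! ### Relative compactness in the strip -/

theorem stripMeasure_eq_prod (T : ℝ) :
    stripMeasure T = (volume.restrict (Ioo 0 T)).prod (volume : Measure ℝ) := by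
  rw [stripMeasure, Measure.volume_eq_prod, ← Measure.prod_restrict, Measure.restrict_univ]

theorem measurable_uncurry_rightAverage {r : ℝ → ℝ → ℝ} (hr : Measurable (Function.uncurry r))
    (h : ℝ) : Measurable (Function.uncurry fun t x => rightAverage h (r t) x) := by
  have hm : Measurable (Function.uncurry fun (p : ℝ × ℝ) (y : ℝ) => r p.1 (p.2 + y)) :=
    hr.comp (by fun_prop : Measurable fun q : (ℝ × ℝ) × ℝ => (q.1.1, q.1.2 + q.2))
  exact (hm.stronglyMeasurable.integral_prod_right
    (ν := volume.restrict (Ioc 0 h))).measurable.const_mul h⁻¹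

/-- A sequence in `L¹` is relatively compact as soon as finitely many of its terms form an
`ε`-net, for every `ε > 0`. -/
theorem relativelyCompactInL1_of_finite_approx {α : Type*} [MeasurableSpace α] {μ : Measure α}
    {f : ℕ → α → ℝ} (hf : ∀ n, MemLp (f n) 1 μ)
    (h : ∀ ε : ℝ, 0 < ε → ∃ S : Set ℕ, S.Finite ∧ ∀ n, ∃ m ∈ S,
      ∫⁻ x, ‖f n x - f m x‖ₑ ∂μ < ENNReal.ofReal ε) :
    RelativelyCompactInL1 μ f := by
  refine ⟨hf, TotallyBounded.isCompact_of_isClosed (TotallyBounded.closure ?_) isClosed_closure⟩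
  refine Metric.totallyBounded_iff.2 fun ε hε => ?_
  obtain ⟨S, hS, hSε⟩ := h ε hε
  refine ⟨(fun m => (hf m).toLp (f m)) '' S, hS.image _, ?_⟩
  rintro _ ⟨n, rfl⟩
  obtain ⟨m, hm, hnm⟩ := hSε n
  refine mem_iUnion₂.2 ⟨_, mem_image_of_mem _ hm, ?_⟩
  rw [Metric.mem_ball, ← edist_lt_ofReal, Lp.edist_toLp_toLp, eLpNorm_one_eq_lintegral_enorm]
  exact hnm

/-- Comparison of two time-dependent densities through their averages. -/
theorem lintegral_lintegral_sub_le {T L a b : ℝ} {r q : ℝ → ℝ → ℝ}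
    (hr : Measurable (Function.uncurry r)) (hq : Measurable (Function.uncurry q))
    (hrd : ∀ᵐ t ∂volume.restrict (Ioo 0 T),
      IsMassDensity L a b (r t) ∧ IsFiniteMeasure (densityMeasure (r t)))
    (hqd : ∀ᵐ t ∂volume.restrict (Ioo 0 T),
      IsMassDensity L a b (q t) ∧ IsFiniteMeasure (densityMeasure (q t)))
    {δ : ENNReal} (hδ : ∀ᵐ t ∂volume.restrict (Ioo 0 T),
      scaledW1 (densityMeasure (r t)) (densityMeasure (q t)) ≤ δ) {h : ℝ} (hh : 0 < h) :
    ∫⁻ t in Ioo 0 T, ∫⁻ x, ‖r t x - q t x‖ₑ ≤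
      (∫⁻ t in Ioo 0 T, ∫⁻ x, ‖r t x - rightAverage h (r t) x‖ₑ) +
        (∫⁻ t in Ioo 0 T, ∫⁻ x, ‖q t x - rightAverage h (q t) x‖ₑ) +
        ENNReal.ofReal h⁻¹ * (2 * δ) * ENNReal.ofReal T := by
  have hrA := measurable_uncurry_rightAverage hr h
  have hqA := measurable_uncurry_rightAverage hq h
  have hrm : Measurable fun t => ∫⁻ x, ‖r t x - rightAverage h (r t) x‖ₑ :=
    (hr.sub hrA).enorm.lintegral_prod_right'
  have hqm : Measurable fun t => ∫⁻ x, ‖q t x - rightAverage h (q t) x‖ₑ :=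
    (hq.sub hqA).enorm.lintegral_prod_right'
  have hpt : ∀ᵐ t ∂volume.restrict (Ioo 0 T), ∫⁻ x, ‖r t x - q t x‖ₑ ≤
      (∫⁻ x, ‖r t x - rightAverage h (r t) x‖ₑ) + (∫⁻ x, ‖q t x - rightAverage h (q t) x‖ₑ) +
        ENNReal.ofReal h⁻¹ * (2 * δ) := by
    filter_upwards [hrd, hqd, hδ] with t ⟨hrt, _⟩ ⟨hqt, _⟩ hδt
    have m₁ : Measurable fun x => ‖r t x - rightAverage h (r t) x‖ₑ :=
      ((hr.sub hrA).comp measurable_prodMk_left).enorm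
    have m₂ : Measurable fun x => ‖q t x - rightAverage h (q t) x‖ₑ :=
      ((hq.sub hqA).comp measurable_prodMk_left).enorm
    calc ∫⁻ x, ‖r t x - q t x‖ₑ
        ≤ ∫⁻ x, (‖r t x - rightAverage h (r t) x‖ₑ + ‖q t x - rightAverage h (q t) x‖ₑ +
          ‖rightAverage h (r t) x - rightAverage h (q t) x‖ₑ) := by
          refine lintegral_mono fun x => ?_
          calc ‖r t x - q t x‖ₑ
              = ‖(r t x - rightAverage h (r t) x) - (q t x - rightAverage h (q t) x) +
                (rightAverage h (r t) x - rightAverage h (q t) x)‖ₑ := by congr 1; ring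
            _ ≤ _ := (enorm_add_le _ _).trans (by gcongr; exact enorm_sub_le)
      _ = (∫⁻ x, ‖r t x - rightAverage h (r t) x‖ₑ) +
          (∫⁻ x, ‖q t x - rightAverage h (q t) x‖ₑ) +
          ∫⁻ x, ‖rightAverage h (r t) x - rightAverage h (q t) x‖ₑ := by
          have m₁₂ : Measurable fun x =>
            ‖r t x - rightAverage h (r t) x‖ₑ + ‖q t x - rightAverage h (q t) x‖ₑ := m₁.add m₂
          rw [lintegral_add_left m₁₂, lintegral_add_left m₁]
      _ ≤ _ := by
          gcongr
          exact (lintegral_rightAverage_sub_le hrt hqt hh).trans (by gcongr)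
  refine (lintegral_mono_ae hpt).trans_eq ?_
  rw [lintegral_add_right _ measurable_const, lintegral_add_left hrm, setLIntegral_const,
    Real.volume_Ioo, sub_zero]

theorem theorem3p14
    (T L a b : ℝ) (hT : 0 < T) (hL : 0 < L)
    (w : ℝ → ℝ) (hwLip : ∃ K : NNReal, LipschitzWith K w)
    (hwmono : StrictMono w ∨ StrictAnti w)
    (ρ : ℕ → ℝ → ℝ → ℝ)
    -- `ρⁿ` is in `L^∞(]0,T[ × ℝ)`, and every `ρⁿ(t)` is (the density of) an element of `M_L`
    (hLinfty : ∀ n, MemLp (fun p : ℝ × ℝ => ρ n p.1 p.2) ⊤ (stripMeasure T))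
    (hmass : ∀ n, ∀ t ∈ Set.Ioo 0 T,
      (∀ᵐ x, 0 ≤ ρ n t x) ∧ densityMeasure (ρ n t) ∈ massClass L)
    -- either `w` is unbounded on `[0,∞[`, or the sequence is bounded in `L^∞`
    (hbdd : Filter.Tendsto (fun r => |w r|) Filter.atTop Filter.atTop ∨
      ∃ R : ℝ, ∀ n, ∀ᵐ p ∂(stripMeasure T), ρ n p.1 p.2 ≤ R)
    (hmeas : ∀ n, MeasurableIntoL1 T (ρ n))
    (hsupp : ∀ n, ∀ t ∈ Set.Ioo 0 T, (densityMeasure (ρ n t)).support ⊆ Set.Ioo a b)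
    (hTV : ∃ K : NNReal, ∀ n,
      ∫⁻ t in Set.Ioo 0 T,
        (eLpNorm (fun x => w (ρ n t x)) 1 (volume.restrict (Set.Ioo a b)) +
          essVariation (fun x => w (ρ n t x)) (Set.Ioo a b)) ≤ K)
    (hW : ∃ C : NNReal, ∀ n, ∀ s ∈ Set.Ioo 0 T, ∀ t ∈ Set.Ioo 0 T,
      scaledW1 (densityMeasure (ρ n s)) (densityMeasure (ρ n t)) ≤ C * ENNReal.ofReal |t - s|) :
    RelativelyCompactInL1 (stripMeasure T) (fun n (p : ℝ × ℝ) => ρ n p.1 p.2) := by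
  obtain ⟨Kw, hKw⟩ := hwLip
  have hinj : Function.Injective w := hwmono.elim StrictMono.injective StrictAnti.injective
  obtain ⟨K, hK⟩ := hTV
  obtain ⟨C, hC⟩ := hW
  have hab : a < b := by
    have ht : T / 2 ∈ Ioo 0 T := ⟨by linarith, by linarith⟩
    by_contra! hba
    have h0 := cumul_eq_zero (hsupp 0 _ ht) le_rfl
    have h1 := cumul_eq_of_le hL.le (hmass 0 _ ht).2 (hsupp 0 _ ht) hba
    linarith
  -- jointly measurable versions of the densities
  have hver : ∀ n, ∃ r : ℝ → ℝ → ℝ, Measurable (Function.uncurry r) ∧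
      (fun p : ℝ × ℝ => ρ n p.1 p.2) =ᵐ[stripMeasure T] Function.uncurry r := fun n =>
    ⟨fun t x => (hLinfty n).1.mk _ (t, x), (hLinfty n).1.stronglyMeasurable_mk.measurable,
      (hLinfty n).1.ae_eq_mk⟩
  choose r hrm hre using hver
  have hslice : ∀ n, ∀ᵐ t ∂volume.restrict (Ioo 0 T), ρ n t =ᵐ[volume] r n t := fun n => by
    have := hre n
    rw [stripMeasure_eq_prod] at this
    exact Measure.ae_ae_of_ae_prod this
  have hdens : ∀ n, ∀ᵐ t ∂volume.restrict (Ioo 0 T),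
      densityMeasure (r n t) = densityMeasure (ρ n t) := fun n =>
    (hslice n).mono fun t ht =>
      withDensity_congr_ae (ht.symm.mono fun x hx => by simp only [hx])
  have hmem : ∀ n, ∀ᵐ t ∂volume.restrict (Ioo 0 T),
      IsMassDensity L a b (r n t) ∧ IsFiniteMeasure (densityMeasure (r n t)) := fun n => by
    filter_upwards [hslice n, hdens n, ae_restrict_mem measurableSet_Ioo] with t ht hd htT
    have hm := (hmass n t htT).2
    have hs := hsupp n t htT
    rw [← hd] at hm hs
    refine ⟨isMassDensity_of_mem_massClass ((hrm n).comp measurable_prodMk_left) ?_ hm hs,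
      isFiniteMeasure_of_mem_massClass hm⟩
    filter_upwards [ht, (hmass n t htT).1] with x hx h0
    exact hx ▸ h0
  have hr : ∀ n, ∀ᵐ t ∂volume.restrict (Ioo 0 T), IsMassDensity L a b (r n t) :=
    fun n => (hmem n).mono fun t ht => ht.1
  have hbound : ∀ M : ℝ, 0 < M → ∃ R : ℝ, ∀ n, ∀ᵐ t ∂volume.restrict (Ioo 0 T),
      bvNorm w a b (r n t) ≤ ENNReal.ofReal M → ∀ᵐ x, r n t x ≤ R := by
    intro M hM
    rcases hbdd with hcoer | ⟨R, hR⟩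
    · obtain ⟨R, hR⟩ := IsMassDensity.exists_le_of_bvNorm_le (L := L) hab hcoer hM.le
      exact ⟨R, fun n => (hr n).mono fun t ht => hR _ ht⟩
    · refine ⟨R, fun n => ?_⟩
      have h1 := hR n
      rw [stripMeasure_eq_prod] at h1
      filter_upwards [Measure.ae_ae_of_ae_prod h1, hslice n] with t ht hs _
      filter_upwards [ht, hs] with x hx hsx
      exact hsx ▸ hx
  have hKr : ∀ n, ∫⁻ t in Ioo 0 T, bvNorm w a b (r n t) ≤ K := fun n => by
    refine le_trans (le_of_eq ?_) (hK n)
    exact lintegral_congr_ae ((hslice n).mono fun t ht => bvNorm_congr ht.symm)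
  have hstrip : ∀ f g : ℝ → ℝ → ℝ, ∫⁻ p, ‖f p.1 p.2 - g p.1 p.2‖ₑ ∂stripMeasure T ≤
      ∫⁻ t in Ioo 0 T, ∫⁻ x, ‖f t x - g t x‖ₑ := fun f g => by
    rw [stripMeasure_eq_prod]
    exact lintegral_prod_le _
  refine relativelyCompactInL1_of_finite_approx (fun n => ⟨(hLinfty n).1, ?_⟩) fun ε hε => ?_
  · rw [eLpNorm_one_eq_lintegral_enorm]
    calc ∫⁻ p, ‖ρ n p.1 p.2‖ₑ ∂stripMeasure T = ∫⁻ p, ‖r n p.1 p.2 - 0‖ₑ ∂stripMeasure T :=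
          lintegral_congr_ae ((hre n).mono fun p hp => by
            simp only [sub_zero]
            exact congrArg _ hp)
      _ ≤ ∫⁻ t in Ioo 0 T, ∫⁻ x, ‖r n t x - 0‖ₑ := hstrip (r n) fun _ _ => 0
      _ = ∫⁻ _ in Ioo 0 T, ENNReal.ofReal L :=
          lintegral_congr_ae ((hr n).mono fun t ht => by simpa using ht.lintegral_eq)
      _ < ⊤ := by
          rw [setLIntegral_const, Real.volume_Ioo]
          exact ENNReal.mul_lt_top ENNReal.ofReal_lt_top ENNReal.ofReal_lt_top
  · obtain ⟨h, hh, hA⟩ := exists_lintegral_sub_rightAverage_le hT hL.le hKw.continuous hinj hr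
      hbound hKr (δ := ε / 4) (by positivity)
    obtain ⟨S, hS, hSn⟩ := exists_finite_forall_scaledW1_le hL.le (fun n t ht => (hmass n t ht).2)
      hsupp hC (δ := ε * h / (8 * T)) (by positivity)
    refine ⟨S, hS, fun n => ?_⟩
    obtain ⟨m, hm, hnm⟩ := hSn n
    refine ⟨m, hm, ?_⟩
    have hW1 : ∀ᵐ t ∂volume.restrict (Ioo 0 T),
        scaledW1 (densityMeasure (r n t)) (densityMeasure (r m t)) ≤
          ENNReal.ofReal (ε * h / (8 * T)) := by
      filter_upwards [hdens n, hdens m, ae_restrict_mem measurableSet_Ioo] with t h1 h2 ht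
      rw [h1, h2]
      exact hnm t ht
    calc ∫⁻ p, ‖ρ n p.1 p.2 - ρ m p.1 p.2‖ₑ ∂stripMeasure T
        = ∫⁻ p, ‖r n p.1 p.2 - r m p.1 p.2‖ₑ ∂stripMeasure T := by
          refine lintegral_congr_ae ?_
          filter_upwards [hre n, hre m] with p h1 h2
          rw [h1, h2]
          rfl
      _ ≤ ∫⁻ t in Ioo 0 T, ∫⁻ x, ‖r n t x - r m t x‖ₑ := hstrip _ _
      _ ≤ ENNReal.ofReal (ε / 4) + ENNReal.ofReal (ε / 4) +
          ENNReal.ofReal h⁻¹ * (2 * ENNReal.ofReal (ε * h / (8 * T))) * ENNReal.ofReal T :=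
        (lintegral_lintegral_sub_le (hrm n) (hrm m) (hmem n) (hmem m) hW1 hh).trans
          (by gcongr; exacts [hA n, hA m])
      _ = ENNReal.ofReal (3 * ε / 4) := by
          rw [← ENNReal.ofReal_ofNat 2, ← ENNReal.ofReal_mul zero_le_two,
            ← ENNReal.ofReal_mul (by positivity), ← ENNReal.ofReal_mul (by positivity),
            ← ENNReal.ofReal_add (by positivity) (by positivity),
            ← ENNReal.ofReal_add (by positivity) (by positivity)]
          congr 1
          field_simp
          ring
      _ < ENNReal.ofReal ε := (ENNReal.ofReal_lt_ofReal_iff hε).2 (by linarith)
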